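/- Let $\mathcal A=\{a_i : i\ge 1\}$ be a countably infinite alphabet, and let $\mathbf P=\{p_i : i\ge 1\}$ be a probability distribution on $\mathcal A$ (some, even infinitely many, of the $p_i$ may be $0$). Let $g:[0,1]\to\mathbb R$ be differentiable on $[0,1]$ (one-sidedly at the endpoints), and suppose that $g'$ is $\beta$-Hölder continuous for some $\beta\in(0,1]$, i.e. there is $M>0$ with $|g'(x)-g'(y)|\le M|x-y|^\beta$ for all $x,y\in[0,1]$. Assume $\sum_{i}|g(p_i)|<\infty$, and put $\theta=\sum_{i} g(p_i)$, $$\sigma^2=\sum_{i=1}^\infty p_i\,g'(p_i)^2-\Big(\sum_{i=1}^\infty p_i\,g'(p_i)\Big)^2,\qquad \gamma=\begin{cases}\beta/2 & \text{if } \beta\in(0,1/2],\\ \beta-1/2 & \text{if } \beta\in(1/2,1],\end{cases}$$ and assume $\sigma^2>0$, with $\sigma=\sqrt{\sigma^2}$. Suppose that either 1. $\beta\in(1/2,1]$, or 2. $\beta\in(0,1/2]$ and $\sum_{i=1}^\infty p_i^{(\beta+1)/2}<\infty$. Then there is a constant $C$, depending only on $g$, $\beta$ and $\mathbf P$, such that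 for every sequence $X_1,X_2,\dots$ of independent $\mathcal A$-valued random variables with distribution $\mathbf P$ and every $n\ge 1$, $$\sup_{x\in\mathbb R}\left|\mathbb P\!\left(\frac{\sqrt n}{\sigma}\,(\hat\theta_n-\theta)\le x\right)-\Phi(x)\right|\le \frac{C}{n^{\gamma/2}},$$ where $\hat p_i=\frac1n\sum_{k=1}^n I_{\{X_k=a_i\}}$ is the sample proportion of $a_i$, $\hat\theta_n=\sum_{i=1}^\infty g(\hat p_i)$ is the plug-in estimator of $\theta$, and $\Phi$ is the standard normal distribution function. -/

import Mathlib

open MeasureTheory ProbabilityTheory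
open scoped NNReal

noncomputable section

namespace DiversityIndex

/-- The derivative of a function on the interval `[0, 1]` (one-sided at the endpoints). -/
def deriv01 (g : ℝ → ℝ) (x : ℝ) : ℝ :=
  derivWithin g (Set.Icc 0 1) x

/-- `p` is a probability distribution on the alphabet `A`; some of the `p a` may vanish. -/
structure IsDistribution {A : Type*} (p : A → ℝ) : Prop where
  nonneg : ∀ a, 0 ≤ p a
  hasSum : HasSum p 1

/-- The index `∑ g (p a)`, the sum running over all letters of the alphabet. -/
def index {A : Type*} (g : ℝ → ℝ) (p : A → ℝ) : ℝ :=
  ∑' a, g (p a)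

/-- The asymptotic variance `∑ p a * g'(p a)^2 - (∑ p a * g'(p a))^2`. -/
def asympVar {A : Type*} (g : ℝ → ℝ) (p : A → ℝ) : ℝ :=
  (∑' a, p a * (deriv01 g (p a)) ^ 2) - (∑' a, p a * deriv01 g (p a)) ^ 2

/-- The sample proportion of the letter `a` among the first `n` terms of the sequence `x`. -/
def sampleProp {A : Type*} (n : ℕ) (x : ℕ → A) (a : A) : ℝ :=
  (1 / (n : ℝ)) * ∑ k ∈ Finset.range n, ({a} : Set A).indicator (fun _ => (1 : ℝ)) (x k)

/-- The plug-in estimator of the index based on the first `n` observations. -/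
def plugIn {A : Type*} (g : ℝ → ℝ) (n : ℕ) (x : ℕ → A) : ℝ :=
  index g (sampleProp n x)

/-- The exponent `γ`: it is `β / 2` for `β ≤ 1 / 2` and `β - 1 / 2` for `β > 1 / 2`. -/
def rateExponent (β : ℝ) : ℝ :=
  if β ≤ 1 / 2 then β / 2 else β - 1 / 2

/-- The observations `X 0, X 1, …` are independent, each with distribution `p`. -/
structure IsIIDSample {Ω A : Type*} [MeasurableSpace Ω] [MeasurableSpace A]
    (μ : Measure Ω) (X : ℕ → Ω → A) (p : A → ℝ) : Prop where
  measurable : ∀ k, Measurable (X k)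
  indep : iIndepFun X μ
  law : ∀ k a, μ.real {ω | X k ω = a} = p a

end DiversityIndex

end

/-!
Linearize: `√n (θ̂ₙ - θ) / σ` is the normalized sum of the centred bounded variables
`g'(p (X k)) - ∑ p b * g'(p b)` plus `√n / σ` times the sum over the letters `a` of the Taylor
errors of `g` at `p a`. By Hölder continuity these errors are at most `M * |p̂ a - p a| ^ (1 + β)`,
whose expectations sum to `O(n ^ (-(1 / 2 + γ)))`: for `β ≤ 1 / 2` by Jensen's inequality from the
variance `≤ p a / n`, and for `β > 1 / 2` by interpolating between the first absolute moment
`≤ 2 * p a` and the second.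

The distance of the whole to the normal law is measured first with `L`-Lipschitz test functions,
for which Stein's method gives `O((1 + L) / √n)` for the linear part and the remainder costs
`O(L * n ^ (-γ))`. Sandwiching the indicator of a half-line between test functions with
`L = 1 / δ` costs a further `δ`, and the choice `δ = n ^ (-γ / 2)` balances the errors.
-/

namespace DiversityIndex

open Filter Set Real

section GaussianDensity

local notation "φ" => gaussianPDFReal 0 1

lemma gaussianPDFReal_zero_one (x : ℝ) : φ x = (√(2 * π))⁻¹ * exp (-x ^ 2 / 2) := by
  simp [gaussianPDFReal]

lemma gaussianPDFReal_zero_one_pos (x : ℝ) : 0 < φ x :=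
  gaussianPDFReal_pos 0 1 x one_ne_zero

lemma gaussianPDFReal_zero_one_neg (x : ℝ) : φ (-x) = φ x := by
  simp [gaussianPDFReal_zero_one]

lemma hasDerivAt_gaussianPDFReal_zero_one (x : ℝ) : HasDerivAt φ (-(x * φ x)) x := by
  have hexponent : HasDerivAt (fun t : ℝ => -t ^ 2 / 2) (-x) x :=
    ((hasDerivAt_pow 2 x).neg.div_const 2).congr_deriv (by norm_num; ring)
  refine ((hexponent.exp.const_mul (√(2 * π))⁻¹).congr_deriv ?_).congr_of_eventuallyEq
    (.of_forall gaussianPDFReal_zero_one)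
  rw [gaussianPDFReal_zero_one]
  ring

lemma tendsto_gaussianPDFReal_zero_one_atTop : Tendsto φ atTop (nhds 0) := by
  have hexponent : Tendsto (fun t : ℝ => -t ^ 2 / 2) atTop atBot := by
    simp only [neg_div]
    exact tendsto_neg_atTop_atBot.comp ((tendsto_pow_atTop two_ne_zero).atTop_div_const two_pos)
  simpa only [mul_zero, funext gaussianPDFReal_zero_one, Function.comp_def] using
    (tendsto_exp_atBot.comp hexponent).const_mul (√(2 * π))⁻¹

lemma mul_integral_Ioi_gaussianPDFReal_le {x : ℝ} (hx : 0 ≤ x) : x * ∫ t in Ioi x, φ t ≤ φ x := by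
  have hderiv : ∀ t ∈ Ici x, HasDerivAt (fun t => -φ t) (t * φ t) t := fun t _ =>
    (hasDerivAt_gaussianPDFReal_zero_one t).neg.congr_deriv (neg_neg _)
  have hlim : Tendsto (fun t => -φ t) atTop (nhds 0) := by
    simpa only [neg_zero] using tendsto_gaussianPDFReal_zero_one_atTop.neg
  have hint : IntegrableOn (fun t => t * φ t) (Ioi x) :=
    integrableOn_Ioi_deriv_of_nonneg' hderiv
      (fun t ht => mul_nonneg (hx.trans (le_of_lt ht)) (gaussianPDFReal_nonneg 0 1 t)) hlim
  calc x * ∫ t in Ioi x, φ t = ∫ t in Ioi x, x * φ t := (integral_const_mul _ _).symm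
    _ ≤ ∫ t in Ioi x, t * φ t :=
        setIntegral_mono_on ((integrable_gaussianPDFReal 0 1).const_mul x).integrableOn hint
          measurableSet_Ioi fun t ht =>
            mul_le_mul_of_nonneg_right (le_of_lt ht) (gaussianPDFReal_nonneg 0 1 t)
    _ = φ x := by rw [integral_Ioi_of_hasDerivAt_of_tendsto' hderiv hint hlim]; ring

lemma integral_Ioi_gaussianPDFReal_le {x : ℝ} (hx : 0 ≤ x) :
    ∫ t in Ioi x, φ t ≤ √(2 * π) * φ x := by
  have hint : Integrable fun t => √(2 * π) * φ x * φ (t - x) :=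
    ((integrable_gaussianPDFReal 0 1).comp_sub_right x).const_mul _
  -- Since `t ^ 2 ≥ x ^ 2 + (t - x) ^ 2` for `t ≥ x ≥ 0`, the tail at `x` is dominated by a shift.
  have hshift : ∀ t ∈ Ioi x, φ t ≤ √(2 * π) * φ x * φ (t - x) := fun t ht => by
    have hexp : exp (-t ^ 2 / 2) ≤ exp (-x ^ 2 / 2) * exp (-(t - x) ^ 2 / 2) := by
      rw [← exp_add]
      exact exp_le_exp.2 (by nlinarith [mul_nonneg hx (sub_nonneg.2 (le_of_lt ht))])
    simp only [gaussianPDFReal_zero_one]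
    calc (√(2 * π))⁻¹ * exp (-t ^ 2 / 2)
        ≤ (√(2 * π))⁻¹ * (exp (-x ^ 2 / 2) * exp (-(t - x) ^ 2 / 2)) := by gcongr
      _ = _ := by field_simp
  calc ∫ t in Ioi x, φ t ≤ ∫ t in Ioi x, √(2 * π) * φ x * φ (t - x) :=
        setIntegral_mono_on (integrable_gaussianPDFReal 0 1).integrableOn hint.integrableOn
          measurableSet_Ioi hshift
    _ ≤ ∫ t, √(2 * π) * φ x * φ (t - x) :=
        setIntegral_le_integral hint (.of_forall fun t =>
          mul_nonneg (mul_nonneg (sqrt_nonneg _) (gaussianPDFReal_nonneg 0 1 x))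
            (gaussianPDFReal_nonneg 0 1 (t - x)))
    _ = √(2 * π) * φ x := by
        rw [integral_const_mul, integral_sub_right_eq_self φ,
          integral_gaussianPDFReal_eq_one 0 one_ne_zero, mul_one]

lemma abs_setIntegral_Iic_le_integral_Ioi {q : ℝ → ℝ} (hq : Integrable q)
    (hqφ : ∀ t, |q t| ≤ φ t) (hq0 : ∫ t, q t = 0) (x : ℝ) :
    |∫ t in Iic x, q t| ≤ ∫ t in Ioi |x|, φ t := by
  have hbound : ∀ s : Set ℝ, |∫ t in s, q t| ≤ ∫ t in s, φ t := fun s => by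
    rw [← norm_eq_abs]
    exact norm_integral_le_of_norm_le (integrable_gaussianPDFReal 0 1).integrableOn
      (.of_forall hqφ)
  rcases le_total 0 x with hx | hx
  · have hcompl : ∫ t in Iic x, q t = -∫ t in Ioi x, q t := by
      rw [eq_neg_iff_add_eq_zero, intervalIntegral.integral_Iic_add_Ioi hq.integrableOn
        hq.integrableOn, hq0]
    rw [abs_of_nonneg hx, hcompl, abs_neg]
    exact hbound _
  · have hreflect : ∫ t in Iic x, φ t = ∫ t in Ioi (-x), φ t := by
      rw [← integral_comp_neg_Iic]
      simp only [gaussianPDFReal_zero_one_neg]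
    rw [abs_of_nonpos hx, ← hreflect]
    exact hbound _

lemma cdf_gaussianReal_add_le (x : ℝ) {δ : ℝ} (hδ : 0 ≤ δ) :
    cdf (gaussianReal 0 1) (x + δ) ≤ cdf (gaussianReal 0 1) x + δ := by
  have hpdf : ∀ t, gaussianPDF 0 1 t ≤ 1 := fun t => by
    rw [gaussianPDF, gaussianPDFReal_zero_one, ENNReal.ofReal_le_one]
    refine mul_le_one₀ (inv_le_one_of_one_le₀ ?_) (exp_nonneg _) (exp_le_one_iff.2 ?_)
    · rw [one_le_sqrt]
      linarith [pi_gt_three]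
    · exact div_nonpos_of_nonpos_of_nonneg (neg_nonpos.2 (sq_nonneg t)) zero_le_two
  have hIoc : gaussianReal 0 1 (Ioc x (x + δ)) ≤ ENNReal.ofReal δ := by
    calc gaussianReal 0 1 (Ioc x (x + δ)) ≤ ∫⁻ _ in Ioc x (x + δ), 1 := by
          rw [gaussianReal_apply _ one_ne_zero]
          exact lintegral_mono hpdf
      _ = ENNReal.ofReal δ := by rw [setLIntegral_one, volume_Ioc, add_sub_cancel_left]
  rw [← sub_le_iff_le_add', cdf_eq_real, cdf_eq_real, ← measureReal_sdiff
    (Iic_subset_Iic.2 (le_add_of_nonneg_right hδ)) measurableSet_Iic, Iic_sdiff_Iic]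
  exact ENNReal.toReal_le_of_le_ofReal hδ hIoc

end GaussianDensity

lemma hasDerivAt_setIntegral_Iic {q : ℝ → ℝ} (hq : Integrable q) (hqc : Continuous q) (x : ℝ) :
    HasDerivAt (fun y => ∫ t in Iic y, q t) (q x) x := by
  have hsplit : (fun y => ∫ t in Iic y, q t) =
      fun y => (∫ t in Iic 0, q t) + ∫ t in (0 : ℝ)..y, q t := by
    ext y
    rw [← intervalIntegral.integral_Iic_sub_Iic hq.integrableOn hq.integrableOn,
      add_sub_cancel]
  rw [hsplit]
  exact (intervalIntegral.integral_hasDerivAt_right (hqc.intervalIntegrable _ _)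
    (hqc.stronglyMeasurableAtFilter _ _) hqc.continuousAt).const_add _

/-- The test functions of the smoothing argument: `[0, 1]`-valued and `L`-Lipschitz. -/
structure IsTestFunction (L : ℝ≥0) (h : ℝ → ℝ) : Prop where
  lipschitz : LipschitzWith L h
  mem_Icc : ∀ x, h x ∈ Icc (0 : ℝ) 1

namespace IsTestFunction

variable {L : ℝ≥0} {h : ℝ → ℝ}

lemma abs_le_one (hh : IsTestFunction L h) (x : ℝ) : |h x| ≤ 1 :=
  abs_le.2 ⟨by linarith [(hh.mem_Icc x).1], (hh.mem_Icc x).2⟩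

lemma integrable_comp (hh : IsTestFunction L h) {Ω : Type*} [MeasurableSpace Ω] {μ : Measure Ω}
    [IsFiniteMeasure μ] {Y : Ω → ℝ} (hY : AEMeasurable Y μ) : Integrable (fun ω => h (Y ω)) μ :=
  .of_bound (hh.lipschitz.continuous.measurable.comp_aemeasurable hY).aestronglyMeasurable 1
    (.of_forall fun _ => hh.abs_le_one _)

lemma integrable (hh : IsTestFunction L h) (ν : Measure ℝ) [IsFiniteMeasure ν] : Integrable h ν :=
  hh.integrable_comp aemeasurable_id

lemma abs_sub_integral_le_one (hh : IsTestFunction L h) (ν : Measure ℝ) [IsProbabilityMeasure ν]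
    (x : ℝ) : |h x - ∫ z, h z ∂ν| ≤ 1 := by
  have hmean : ∫ z, h z ∂ν ∈ Icc (0 : ℝ) 1 := by
    refine ⟨integral_nonneg fun z => (hh.mem_Icc z).1, ?_⟩
    simpa using integral_mono (hh.integrable ν) (integrable_const (1 : ℝ)) fun z => (hh.mem_Icc z).2
  rw [abs_le]
  constructor <;> linarith [(hh.mem_Icc x).1, (hh.mem_Icc x).2, hmean.1, hmean.2]

end IsTestFunction

section SteinEquation

local notation "φ" => gaussianPDFReal 0 1

/-- The bounded solution `f` of Stein's equation `f' x - x * f x = h x - 𝔼 h(Z)`, with `Z` standard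
normal. -/
noncomputable def steinSolution (h : ℝ → ℝ) (x : ℝ) : ℝ :=
  (φ x)⁻¹ * ∫ t in Iic x, φ t * (h t - ∫ z, h z ∂gaussianReal 0 1)

/-- The derivative of `steinSolution h`, written in the form given by Stein's equation. -/
noncomputable def steinDeriv (h : ℝ → ℝ) (x : ℝ) : ℝ :=
  x * steinSolution h x + (h x - ∫ z, h z ∂gaussianReal 0 1)

namespace IsTestFunction

variable {L : ℝ≥0} {h : ℝ → ℝ}

lemma abs_gaussianPDFReal_mul_le (hh : IsTestFunction L h) (t : ℝ) :
    |φ t * (h t - ∫ z, h z ∂gaussianReal 0 1)| ≤ φ t := by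
  rw [abs_mul, abs_of_nonneg (gaussianPDFReal_nonneg 0 1 t)]
  exact mul_le_of_le_one_right (gaussianPDFReal_nonneg 0 1 t) (hh.abs_sub_integral_le_one _ t)

lemma integrable_gaussianPDFReal_mul (hh : IsTestFunction L h) :
    Integrable fun t => φ t * (h t - ∫ z, h z ∂gaussianReal 0 1) :=
  (integrable_gaussianPDFReal 0 1).mono' ((measurable_gaussianPDFReal 0 1).mul
    (hh.lipschitz.continuous.measurable.sub_const _)).aestronglyMeasurable
    (.of_forall hh.abs_gaussianPDFReal_mul_le)

lemma integral_gaussianPDFReal_mul (hh : IsTestFunction L h) :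
    ∫ t, φ t * (h t - ∫ z, h z ∂gaussianReal 0 1) = 0 := by
  have hdensity := integral_gaussianReal_eq_integral_smul (μ := 0) one_ne_zero
    (f := fun t => h t - ∫ z, h z ∂gaussianReal 0 1)
  simp only [smul_eq_mul] at hdensity
  rw [← hdensity, integral_sub (hh.integrable _) (integrable_const _)]
  simp

lemma hasDerivAt_steinSolution (hh : IsTestFunction L h) (x : ℝ) :
    HasDerivAt (steinSolution h) (steinDeriv h x) x := by
  have hφ := hasDerivAt_gaussianPDFReal_zero_one
  have hcont : Continuous fun t => φ t * (h t - ∫ z, h z ∂gaussianReal 0 1) :=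
    (continuous_iff_continuousAt.2 fun t => (hφ t).continuousAt).mul
      (hh.lipschitz.continuous.sub continuous_const)
  have hx := (gaussianPDFReal_zero_one_pos x).ne'
  refine (((hφ x).inv hx).mul
    (hasDerivAt_setIntegral_Iic hh.integrable_gaussianPDFReal_mul hcont x)).congr_deriv ?_
  rw [steinDeriv, steinSolution, Pi.inv_apply]
  field_simp

lemma abs_steinSolution_le_tail (hh : IsTestFunction L h) (x : ℝ) :
    |steinSolution h x| ≤ (φ |x|)⁻¹ * ∫ t in Ioi |x|, φ t := by
  have heven : φ |x| = φ x := by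
    rcases abs_choice x with hx | hx <;> rw [hx]
    exact gaussianPDFReal_zero_one_neg x
  rw [heven, steinSolution, abs_mul, abs_of_pos (inv_pos.2 (gaussianPDFReal_zero_one_pos x))]
  gcongr
  · exact inv_nonneg.2 (gaussianPDFReal_nonneg 0 1 x)
  · exact abs_setIntegral_Iic_le_integral_Ioi hh.integrable_gaussianPDFReal_mul
      hh.abs_gaussianPDFReal_mul_le hh.integral_gaussianPDFReal_mul x

lemma abs_steinSolution_le (hh : IsTestFunction L h) (x : ℝ) : |steinSolution h x| ≤ √(2 * π) := by
  refine (hh.abs_steinSolution_le_tail x).trans ?_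
  rw [inv_mul_le_iff₀ (gaussianPDFReal_zero_one_pos _), mul_comm]
  exact integral_Ioi_gaussianPDFReal_le (abs_nonneg x)

lemma abs_mul_steinSolution_le (hh : IsTestFunction L h) (x : ℝ) : |x * steinSolution h x| ≤ 1 := by
  rw [abs_mul]
  refine (mul_le_mul_of_nonneg_left (hh.abs_steinSolution_le_tail x) (abs_nonneg x)).trans ?_
  rw [mul_left_comm, inv_mul_le_iff₀ (gaussianPDFReal_zero_one_pos _), mul_one]
  exact mul_integral_Ioi_gaussianPDFReal_le (abs_nonneg x)

lemma abs_steinDeriv_le (hh : IsTestFunction L h) (x : ℝ) : |steinDeriv h x| ≤ 2 :=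
  (abs_add_le _ _).trans <| by
    linarith [hh.abs_mul_steinSolution_le x, hh.abs_sub_integral_le_one (gaussianReal 0 1) x]

lemma continuous_steinSolution (hh : IsTestFunction L h) : Continuous (steinSolution h) :=
  continuous_iff_continuousAt.2 fun x => (hh.hasDerivAt_steinSolution x).continuousAt

lemma continuous_steinDeriv (hh : IsTestFunction L h) : Continuous (steinDeriv h) :=
  (continuous_id.mul hh.continuous_steinSolution).add
    (hh.lipschitz.continuous.sub continuous_const)

lemma abs_steinSolution_sub_le (hh : IsTestFunction L h) (x y : ℝ) :
    |steinSolution h x - steinSolution h y| ≤ 2 * |x - y| :=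
  convex_univ.norm_image_sub_le_of_norm_hasDerivWithin_le
    (fun z _ => (hh.hasDerivAt_steinSolution z).hasDerivWithinAt)
    (fun z _ => hh.abs_steinDeriv_le z) (mem_univ y) (mem_univ x)

lemma abs_steinDeriv_add_sub_le (hh : IsTestFunction L h) (w u : ℝ) :
    |steinDeriv h (w + u) - steinDeriv h w| ≤ (2 * |w| + (√(2 * π) + L)) * |u| := by
  have hf : |steinSolution h (w + u) - steinSolution h w| ≤ 2 * |u| := by
    simpa using hh.abs_steinSolution_sub_le (w + u) w
  have hlip : |h (w + u) - h w| ≤ L * |u| := by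
    simpa [dist_eq] using hh.lipschitz.dist_le_mul (w + u) w
  calc |steinDeriv h (w + u) - steinDeriv h w|
      = |w * (steinSolution h (w + u) - steinSolution h w) + u * steinSolution h (w + u)
          + (h (w + u) - h w)| := by
        congr 1
        simp only [steinDeriv]
        ring
    _ ≤ |w| * |steinSolution h (w + u) - steinSolution h w| + |u| * |steinSolution h (w + u)|
          + |h (w + u) - h w| := by
        rw [← abs_mul, ← abs_mul]
        exact abs_add_three _ _ _
    _ ≤ |w| * (2 * |u|) + |u| * √(2 * π) + L * |u| := by
        gcongr
        exact hh.abs_steinSolution_le _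
    _ = (2 * |w| + (√(2 * π) + L)) * |u| := by ring

lemma abs_steinSolution_taylor_le (hh : IsTestFunction L h) (w u : ℝ) :
    |steinSolution h (w + u) - steinSolution h w - u * steinDeriv h w|
      ≤ (2 * |w| + (√(2 * π) + L)) * u ^ 2 := by
  have hmvt := (convex_Icc (-|u|) |u|).norm_image_sub_le_of_norm_hasDerivWithin_le
    (f := fun t => steinSolution h (w + t) - t * steinDeriv h w)
    (f' := fun t => steinDeriv h (w + t) - steinDeriv h w)
    (C := (2 * |w| + (√(2 * π) + L)) * |u|) (x := 0) (y := u)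
    (fun t _ => (((hh.hasDerivAt_steinSolution (w + t)).comp_const_add w t).sub
      ((hasDerivAt_id t).mul_const _)).hasDerivWithinAt.congr_deriv (by rw [one_mul]))
    (fun t ht => (hh.abs_steinDeriv_add_sub_le w t).trans
      (mul_le_mul_of_nonneg_left (abs_le.2 ht) (by positivity)))
    (Set.mem_Icc.2 ⟨neg_nonpos.2 (abs_nonneg u), abs_nonneg u⟩) (Set.mem_Icc.2 (abs_le.1 le_rfl))
  simpa [sub_right_comm, mul_assoc, ← sq] using hmvt

end IsTestFunction

end SteinEquation

section BoundedSums

variable {Ω : Type*} [MeasurableSpace Ω] {μ : Measure Ω} {X V : Ω → ℝ} {b : ℝ}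

lemma integrable_sq_mul_comp (hX : MemLp X 2 μ) (hVX : V ⟂ᵢ[μ] X) {F : ℝ → ℝ} (hF : Measurable F)
    (hFV : Integrable (fun ω => F (V ω)) μ) : Integrable (fun ω => X ω ^ 2 * F (V ω)) μ :=
  (hVX.symm.comp (measurable_id.pow_const 2) hF).integrable_mul hX.integrable_sq hFV

lemma integral_sq_mul_comp (hX : MemLp X 2 μ) (hX0 : ∫ ω, X ω ∂μ = 0) (hVX : V ⟂ᵢ[μ] X) {F : ℝ → ℝ}
    (hF : Measurable F) (hFV : Integrable (fun ω => F (V ω)) μ) :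
    ∫ ω, X ω ^ 2 * F (V ω) ∂μ = Var[X; μ] * ∫ ω, F (V ω) ∂μ := by
  rw [variance_of_integral_eq_zero hX.aemeasurable hX0]
  exact (hVX.symm.comp (measurable_id.pow_const 2) hF).integral_fun_mul_eq_mul_integral
    hX.integrable_sq.aestronglyMeasurable hFV.aestronglyMeasurable

variable [IsProbabilityMeasure μ]

lemma sq_integral_abs_le (hV : MemLp V 2 μ) : (∫ ω, |V ω| ∂μ) ^ 2 ≤ ∫ ω, V ω ^ 2 ∂μ := by
  have hvar := variance_nonneg |V| μ
  rw [variance_eq_sub hV.abs, sub_nonneg] at hvar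
  simpa using hvar

lemma integral_two_mul_abs_add (hV : Integrable V μ) (c : ℝ) :
    ∫ ω, (2 * |V ω| + c) ∂μ = 2 * ∫ ω, |V ω| ∂μ + c := by
  rw [integral_add (hV.abs.const_mul 2) (integrable_const c), integral_const_mul]
  simp

namespace IsTestFunction

variable {L : ℝ≥0} {h : ℝ → ℝ}

lemma integrable_steinSolution_comp (hh : IsTestFunction L h) (hV : AEMeasurable V μ) :
    Integrable (fun ω => steinSolution h (V ω)) μ :=
  .of_bound (hh.continuous_steinSolution.measurable.comp_aemeasurable hV).aestronglyMeasurable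
    (√(2 * π)) (.of_forall fun _ => hh.abs_steinSolution_le _)

lemma integrable_steinDeriv_comp (hh : IsTestFunction L h) (hV : AEMeasurable V μ) :
    Integrable (fun ω => steinDeriv h (V ω)) μ :=
  .of_bound (hh.continuous_steinDeriv.measurable.comp_aemeasurable hV).aestronglyMeasurable
    2 (.of_forall fun _ => hh.abs_steinDeriv_le _)

lemma abs_integral_steinDeriv_add_sub_le (hh : IsTestFunction L h) (hX : AEMeasurable X μ)
    (hV : Integrable V μ) (hXb : ∀ᵐ ω ∂μ, |X ω| ≤ b) :
    |∫ ω, steinDeriv h (V ω + X ω) ∂μ - ∫ ω, steinDeriv h (V ω) ∂μ|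
      ≤ b * (2 * ∫ ω, |V ω| ∂μ + (√(2 * π) + L)) := by
  have hDVX : Integrable (fun ω => steinDeriv h (V ω + X ω)) μ :=
    hh.integrable_steinDeriv_comp (hV.aemeasurable.add hX)
  rw [← integral_sub hDVX (hh.integrable_steinDeriv_comp hV.aemeasurable),
    ← integral_two_mul_abs_add hV, ← integral_const_mul]
  refine (norm_eq_abs _).symm.trans_le (norm_integral_le_of_norm_le
    (((hV.abs.const_mul 2).add (integrable_const _)).const_mul b) ?_)
  filter_upwards [hXb] with ω hω
  rw [mul_comm b]
  exact (hh.abs_steinDeriv_add_sub_le _ _).trans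
    (mul_le_mul_of_nonneg_left hω (by positivity))

lemma integral_mul_steinSolution_taylor (hh : IsTestFunction L h) (hX : AEMeasurable X μ)
    (hV : AEMeasurable V μ) (hVX : V ⟂ᵢ[μ] X) (hXb : ∀ᵐ ω ∂μ, |X ω| ≤ b) (hX0 : ∫ ω, X ω ∂μ = 0) :
    ∫ ω, X ω * (steinSolution h (V ω + X ω) - steinSolution h (V ω) - X ω * steinDeriv h (V ω)) ∂μ
      = ∫ ω, X ω * steinSolution h (V ω + X ω) ∂μ - Var[X; μ] * ∫ ω, steinDeriv h (V ω) ∂μ := by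
  have hXsq : MemLp X 2 μ := .of_bound hX.aestronglyMeasurable b hXb
  have hfV := hh.integrable_steinSolution_comp hV
  have hDV := hh.integrable_steinDeriv_comp hV
  have hXfV : Integrable (fun ω => X ω * steinSolution h (V ω)) μ :=
    hfV.bdd_mul hX.aestronglyMeasurable hXb
  have hXfVX : Integrable (fun ω => X ω * steinSolution h (V ω + X ω)) μ :=
    (hh.integrable_steinSolution_comp (hV.add hX)).bdd_mul hX.aestronglyMeasurable hXb
  have hindep : X ⟂ᵢ[μ] fun ω => steinSolution h (V ω) :=
    hVX.symm.comp measurable_id hh.continuous_steinSolution.measurable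
  have hzero : ∫ ω, X ω * steinSolution h (V ω) ∂μ = 0 := by
    rw [hindep.integral_fun_mul_eq_mul_integral hX.aestronglyMeasurable hfV.aestronglyMeasurable,
      hX0, zero_mul]
  have hD := hh.continuous_steinDeriv.measurable
  simp only [mul_sub, ← mul_assoc, ← sq]
  rw [integral_sub (hXfVX.sub' hXfV) (integrable_sq_mul_comp hXsq hVX hD hDV),
    integral_sub hXfVX hXfV, hzero, integral_sq_mul_comp hXsq hX0 hVX hD hDV, sub_zero]

lemma abs_integral_mul_steinSolution_sub_le (hh : IsTestFunction L h) (hX : AEMeasurable X μ)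
    (hV : Integrable V μ) (hVX : V ⟂ᵢ[μ] X) (hXb : ∀ᵐ ω ∂μ, |X ω| ≤ b) (hX0 : ∫ ω, X ω ∂μ = 0) :
    |∫ ω, X ω * steinSolution h (V ω + X ω) ∂μ - Var[X; μ] * ∫ ω, steinDeriv h (V ω) ∂μ|
      ≤ b * Var[X; μ] * (2 * ∫ ω, |V ω| ∂μ + (√(2 * π) + L)) := by
  have hXsq : MemLp X 2 μ := .of_bound hX.aestronglyMeasurable b hXb
  have hmodulus : Measurable fun v : ℝ => 2 * |v| + (√(2 * π) + L) := by fun_prop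
  have hmodulusV : Integrable (fun ω => 2 * |V ω| + (√(2 * π) + L)) μ :=
    (hV.abs.const_mul 2).add (integrable_const _)
  rw [← hh.integral_mul_steinSolution_taylor hX hV.aemeasurable hVX hXb hX0, mul_assoc,
    ← integral_two_mul_abs_add hV, ← integral_sq_mul_comp hXsq hX0 hVX hmodulus hmodulusV,
    ← integral_const_mul]
  refine (norm_eq_abs _).symm.trans_le (norm_integral_le_of_norm_le
    ((integrable_sq_mul_comp hXsq hVX hmodulus hmodulusV).const_mul b) ?_)
  filter_upwards [hXb] with ω hω
  rw [norm_mul, mul_comm (X ω ^ 2)]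
  exact mul_le_mul hω (hh.abs_steinSolution_taylor_le _ _) (norm_nonneg _)
    ((abs_nonneg _).trans hω)

lemma abs_integral_mul_steinSolution_sub_variance_mul_le (hh : IsTestFunction L h)
    (hX : AEMeasurable X μ) (hV : MemLp V 2 μ) (hVX : V ⟂ᵢ[μ] X) (hXb : ∀ᵐ ω ∂μ, |X ω| ≤ b)
    (hX0 : ∫ ω, X ω ∂μ = 0) (hVsq : ∫ ω, V ω ^ 2 ∂μ ≤ 1) :
    |∫ ω, X ω * steinSolution h (V ω + X ω) ∂μ - Var[X; μ] * ∫ ω, steinDeriv h (V ω + X ω) ∂μ|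
      ≤ 2 * b * (2 + √(2 * π) + L) * Var[X; μ] := by
  have hVint : Integrable V μ := hV.integrable one_le_two
  have hb : 0 ≤ b := hXb.exists.elim fun ω hω => (abs_nonneg _).trans hω
  have hVabs : ∫ ω, |V ω| ∂μ ≤ 1 := by
    rw [← sq_le_one_iff₀ (integral_nonneg fun ω => abs_nonneg _)]
    exact (sq_integral_abs_le hV).trans hVsq
  have hvar : 0 ≤ Var[X; μ] := variance_nonneg X μ
  have hstein := hh.abs_integral_mul_steinSolution_sub_le hX hVint hVX hXb hX0
  have hderiv := mul_le_mul_of_nonneg_left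
    (hh.abs_integral_steinDeriv_add_sub_le hX hVint hXb) hvar
  rw [← abs_of_nonneg hvar, ← abs_mul, abs_of_nonneg hvar, mul_sub, abs_sub_comm] at hderiv
  calc _ ≤ _ := abs_sub_le _ (Var[X; μ] * ∫ ω, steinDeriv h (V ω) ∂μ) _
    _ ≤ b * Var[X; μ] * (2 * ∫ ω, |V ω| ∂μ + (√(2 * π) + L))
        + Var[X; μ] * (b * (2 * ∫ ω, |V ω| ∂μ + (√(2 * π) + L))) := add_le_add hstein hderiv
    _ = 2 * b * (2 * ∫ ω, |V ω| ∂μ + (√(2 * π) + L)) * Var[X; μ] := by ring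
    _ ≤ 2 * b * (2 * 1 + (√(2 * π) + L)) * Var[X; μ] := by gcongr
    _ = 2 * b * (2 + √(2 * π) + L) * Var[X; μ] := by ring

end IsTestFunction

variable {ι : Type*} {ξ : ι → Ω → ℝ} {s : Finset ι}

lemma integral_finsetSum_sq_eq_sum_variance (hξ : iIndepFun ξ μ) (hL2 : ∀ k, MemLp (ξ k) 2 μ)
    (h0 : ∀ k, ∫ ω, ξ k ω ∂μ = 0) (s : Finset ι) :
    ∫ ω, (∑ k ∈ s, ξ k ω) ^ 2 ∂μ = ∑ k ∈ s, Var[ξ k; μ] := by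
  have hmean : ∫ ω, (∑ k ∈ s, ξ k) ω ∂μ = 0 := by
    simp only [Finset.sum_apply]
    rw [integral_finsetSum s fun k _ => (hL2 k).integrable one_le_two]
    exact Finset.sum_eq_zero fun k _ => h0 k
  rw [← IndepFun.variance_sum (fun k _ => hL2 k) fun i _ j _ hij => hξ.indepFun hij,
    variance_of_integral_eq_zero (memLp_finsetSum' s fun k _ => hL2 k).aemeasurable hmean]
  simp only [Finset.sum_apply]

namespace IsTestFunction

variable {L : ℝ≥0} {h : ℝ → ℝ}

lemma integral_comp_sum_sub_eq (hh : IsTestFunction L h) (hm : ∀ k, AEMeasurable (ξ k) μ)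
    (hb : ∀ k, ∀ᵐ ω ∂μ, |ξ k ω| ≤ b) (hvar : ∑ k ∈ s, Var[ξ k; μ] = 1) :
    ∫ ω, h (∑ k ∈ s, ξ k ω) ∂μ - ∫ z, h z ∂gaussianReal 0 1
      = -∑ k ∈ s, (∫ ω, ξ k ω * steinSolution h (∑ j ∈ s, ξ j ω) ∂μ
          - Var[ξ k; μ] * ∫ ω, steinDeriv h (∑ j ∈ s, ξ j ω) ∂μ) := by
  have hT : AEMeasurable (fun ω => ∑ j ∈ s, ξ j ω) μ :=
    Finset.aemeasurable_fun_sum s fun k _ => hm k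
  have hξf : ∀ k ∈ s, Integrable (fun ω => ξ k ω * steinSolution h (∑ j ∈ s, ξ j ω)) μ := fun k _ =>
    (hh.integrable_steinSolution_comp hT).bdd_mul (hm k).aestronglyMeasurable (hb k)
  have hequation : ∀ ω, h (∑ j ∈ s, ξ j ω) - ∫ z, h z ∂gaussianReal 0 1
      = steinDeriv h (∑ j ∈ s, ξ j ω) - ∑ k ∈ s, ξ k ω * steinSolution h (∑ j ∈ s, ξ j ω) :=
    fun ω => by
      rw [← Finset.sum_mul, steinDeriv]
      ring
  rw [Finset.sum_sub_distrib, ← Finset.sum_mul, hvar, one_mul, neg_sub,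
    ← integral_finsetSum s hξf, ← integral_sub (hh.integrable_steinDeriv_comp hT)
    (integrable_finsetSum s hξf), ← integral_congr_ae (.of_forall hequation),
    integral_sub (hh.integrable_comp hT) (integrable_const _)]
  simp

theorem abs_integral_comp_sum_sub_le (hh : IsTestFunction L h) (hξ : iIndepFun ξ μ)
    (hm : ∀ k, AEMeasurable (ξ k) μ) (hb : ∀ k, ∀ᵐ ω ∂μ, |ξ k ω| ≤ b)
    (h0 : ∀ k, ∫ ω, ξ k ω ∂μ = 0) (hvar : ∑ k ∈ s, Var[ξ k; μ] = 1) :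
    |∫ ω, h (∑ k ∈ s, ξ k ω) ∂μ - ∫ z, h z ∂gaussianReal 0 1| ≤ 2 * b * (2 + √(2 * π) + L) := by
  classical
  have hL2 : ∀ k, MemLp (ξ k) 2 μ := fun k => .of_bound (hm k).aestronglyMeasurable b (hb k)
  let T : Ω → ℝ := fun ω => ∑ k ∈ s, ξ k ω
  have hterm : ∀ k ∈ s, |∫ ω, ξ k ω * steinSolution h (T ω) ∂μ
      - Var[ξ k; μ] * ∫ ω, steinDeriv h (T ω) ∂μ| ≤ 2 * b * (2 + √(2 * π) + L) * Var[ξ k; μ] :=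
    fun k hk => by
      have hsplit : ∀ ω, T ω = (∑ j ∈ s.erase k, ξ j) ω + ξ k ω := fun ω => by
        rw [Finset.sum_apply, Finset.sum_erase_add _ _ hk]
      simp only [hsplit]
      refine hh.abs_integral_mul_steinSolution_sub_variance_mul_le (hm k)
        (memLp_finsetSum' _ fun j _ => hL2 j)
        (hξ.indepFun_finsetSum_of_notMem₀ hm (Finset.notMem_erase k s)) (hb k) (h0 k) ?_
      simp only [Finset.sum_apply]
      rw [integral_finsetSum_sq_eq_sum_variance hξ hL2 h0, ← hvar]
      exact Finset.sum_le_sum_of_subset_of_nonneg (Finset.erase_subset k s)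
        fun j _ _ => variance_nonneg _ _
  calc _ ≤ ∑ k ∈ s, 2 * b * (2 + √(2 * π) + L) * Var[ξ k; μ] := by
        rw [hh.integral_comp_sum_sub_eq hm hb hvar, abs_neg]
        exact (Finset.abs_sum_le_sum_abs _ _).trans (Finset.sum_le_sum hterm)
    _ = 2 * b * (2 + √(2 * π) + L) := by rw [← Finset.mul_sum, hvar, mul_one]

end IsTestFunction

end BoundedSums

section Smoothing

lemma isTestFunction_thickenedIndicator {δ : ℝ} (hδ : 0 < δ) (E : Set ℝ) :
    IsTestFunction δ.toNNReal⁻¹ fun w => (thickenedIndicator hδ E w : ℝ) where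
  lipschitz := lipschitzWith_thickenedIndicator hδ E
  mem_Icc w := ⟨NNReal.coe_nonneg _, NNReal.coe_le_one.2 (thickenedIndicator_le_one hδ E w)⟩

lemma measureReal_le_measureReal_thickening {ν τ : Measure ℝ} [IsFiniteMeasure ν]
    [IsFiniteMeasure τ] {δ ε : ℝ} (hδ : 0 < δ)
    (h : ∀ f, IsTestFunction δ.toNNReal⁻¹ f → ∫ z, f z ∂ν ≤ ∫ z, f z ∂τ + ε)
    {E : Set ℝ} (hE : MeasurableSet E) : ν.real E ≤ τ.real (Metric.thickening δ E) + ε := by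
  have hf := isTestFunction_thickenedIndicator hδ E
  have hν : ν.real E ≤ ∫ z, (thickenedIndicator hδ E z : ℝ) ∂ν := by
    rw [← integral_indicator_one hE]
    refine integral_mono ((integrable_const 1).indicator hE) (hf.integrable ν) fun z => ?_
    refine indicator_le' (fun y hy => ?_) (fun _ _ => NNReal.coe_nonneg _) z
    simp [thickenedIndicator_one hδ E hy]
  have hτ : ∫ z, (thickenedIndicator hδ E z : ℝ) ∂τ ≤ τ.real (Metric.thickening δ E) := by
    have hthick : MeasurableSet (Metric.thickening δ E) := Metric.isOpen_thickening.measurableSet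
    rw [← integral_indicator_one hthick]
    refine integral_mono (hf.integrable τ) ((integrable_const 1).indicator hthick) fun z => ?_
    refine le_indicator (fun y _ => (hf.mem_Icc y).2) (fun y hy => ?_) z
    simp [thickenedIndicator_zero hδ E hy]
  linarith [h _ hf]

lemma thickening_Iic_subset (x δ : ℝ) : Metric.thickening δ (Iic x) ⊆ Iic (x + δ) := fun w hw => by
  obtain ⟨z, hz, hwz⟩ := Metric.mem_thickening_iff.1 hw
  rw [dist_eq] at hwz
  exact mem_Iic.2 (by linarith [mem_Iic.1 hz, le_abs_self (w - z)])

lemma cdf_le_cdf_add {ν τ : Measure ℝ} [IsProbabilityMeasure ν] [IsProbabilityMeasure τ]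
    {δ ε : ℝ} (hδ : 0 < δ)
    (h : ∀ f, IsTestFunction δ.toNNReal⁻¹ f → ∫ z, f z ∂ν ≤ ∫ z, f z ∂τ + ε) (x : ℝ) :
    cdf ν x ≤ cdf τ (x + δ) + ε := by
  rw [cdf_eq_real, cdf_eq_real]
  exact (measureReal_le_measureReal_thickening hδ h measurableSet_Iic).trans
    (add_le_add_left (measureReal_mono (thickening_Iic_subset x δ)) ε)

lemma abs_cdf_sub_cdf_gaussianReal_le {ν : Measure ℝ} [IsProbabilityMeasure ν] {δ ε : ℝ}
    (hδ : 0 < δ)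
    (h : ∀ f, IsTestFunction δ.toNNReal⁻¹ f → |∫ z, f z ∂ν - ∫ z, f z ∂gaussianReal 0 1| ≤ ε)
    (x : ℝ) : |cdf ν x - cdf (gaussianReal 0 1) x| ≤ ε + δ := by
  have hupper : cdf ν x ≤ cdf (gaussianReal 0 1) (x + δ) + ε :=
    cdf_le_cdf_add hδ (fun f hf => by linarith [(abs_le.1 (h f hf)).2]) x
  have hlower : cdf (gaussianReal 0 1) (x - δ) ≤ cdf ν (x - δ + δ) + ε :=
    cdf_le_cdf_add hδ (fun f hf => by linarith [(abs_le.1 (h f hf)).1]) (x - δ)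
  have hgauss := cdf_gaussianReal_add_le (x - δ) hδ.le
  rw [sub_add_cancel] at hlower hgauss
  exact abs_le.2 ⟨by linarith, by linarith [cdf_gaussianReal_add_le x hδ.le]⟩

variable {Ω : Type*} [MeasurableSpace Ω] {μ : Measure Ω}

lemma IsTestFunction.abs_integral_comp_sub_le {L : ℝ≥0} {h : ℝ → ℝ} [IsFiniteMeasure μ]
    (hh : IsTestFunction L h) {W T : Ω → ℝ} (hW : AEMeasurable W μ) (hT : AEMeasurable T μ)
    (hWT : Integrable (fun ω => W ω - T ω) μ) :
    |∫ ω, h (W ω) ∂μ - ∫ ω, h (T ω) ∂μ| ≤ L * ∫ ω, |W ω - T ω| ∂μ := by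
  rw [← integral_sub (hh.integrable_comp hW) (hh.integrable_comp hT), ← integral_const_mul]
  exact (norm_eq_abs _).symm.trans_le (norm_integral_le_of_norm_le (hWT.abs.const_mul _)
    (.of_forall fun ω => hh.lipschitz.norm_sub_le (W ω) (T ω)))

variable [IsProbabilityMeasure μ] {ι : Type*} {ξ : ι → Ω → ℝ} {s : Finset ι} {W : Ω → ℝ} {b : ℝ}

theorem abs_measureReal_le_sub_cdf_le_of_smoothing (hξ : iIndepFun ξ μ)
    (hm : ∀ k, AEMeasurable (ξ k) μ)
    (hb : ∀ k, ∀ᵐ ω ∂μ, |ξ k ω| ≤ b) (h0 : ∀ k, ∫ ω, ξ k ω ∂μ = 0)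
    (hvar : ∑ k ∈ s, Var[ξ k; μ] = 1) (hW : AEMeasurable W μ)
    (hWξ : Integrable (fun ω => W ω - ∑ k ∈ s, ξ k ω) μ) {δ : ℝ} (hδ : 0 < δ) (x : ℝ) :
    |μ.real {ω | W ω ≤ x} - cdf (gaussianReal 0 1) x|
      ≤ 2 * b * (2 + √(2 * π) + δ⁻¹) + δ⁻¹ * ∫ ω, |W ω - ∑ k ∈ s, ξ k ω| ∂μ + δ := by
  have : IsProbabilityMeasure (μ.map W) := Measure.isProbabilityMeasure_map hW
  have hcdf : μ.real {ω | W ω ≤ x} = cdf (μ.map W) x := by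
    rw [cdf_eq_real, map_measureReal_apply_of_aemeasurable hW measurableSet_Iic]
    rfl
  have hL : ((δ.toNNReal⁻¹ : ℝ≥0) : ℝ) = δ⁻¹ := by rw [NNReal.coe_inv, coe_toNNReal δ hδ.le]
  rw [hcdf]
  refine abs_cdf_sub_cdf_gaussianReal_le hδ (fun f hf => ?_) x
  have hT : AEMeasurable (fun ω => ∑ k ∈ s, ξ k ω) μ :=
    Finset.aemeasurable_fun_sum s fun k _ => hm k
  have hlinear := hf.abs_integral_comp_sub_le hW hT hWξ
  have hstein := hf.abs_integral_comp_sum_sub_le hξ hm hb h0 hvar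
  rw [hL] at hlinear hstein
  rw [integral_map hW hf.lipschitz.continuous.aestronglyMeasurable]
  exact (abs_sub_le _ _ _).trans ((add_le_add hlinear hstein).trans_eq (add_comm _ _))

theorem abs_measureReal_le_sub_cdf_le (hξ : iIndepFun ξ μ) (hm : ∀ k, AEMeasurable (ξ k) μ)
    (hb : ∀ k, ∀ᵐ ω ∂μ, |ξ k ω| ≤ b) (h0 : ∀ k, ∫ ω, ξ k ω ∂μ = 0)
    (hvar : ∑ k ∈ s, Var[ξ k; μ] = 1) (hW : AEMeasurable W μ)
    (hWξ : Integrable (fun ω => W ω - ∑ k ∈ s, ξ k ω) μ) {B Q δ : ℝ} (hδ : 0 < δ) (hδ1 : δ ≤ 1)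
    (hB : 0 ≤ B) (hbB : b ≤ B * δ ^ 2) (hQ : ∫ ω, |W ω - ∑ k ∈ s, ξ k ω| ∂μ ≤ Q * δ ^ 2) (x : ℝ) :
    |μ.real {ω | W ω ≤ x} - cdf (gaussianReal 0 1) x| ≤ (2 * B * (3 + √(2 * π)) + Q + 1) * δ := by
  refine (abs_measureReal_le_sub_cdf_le_of_smoothing hξ hm hb h0 hvar hW hWξ hδ x).trans ?_
  calc 2 * b * (2 + √(2 * π) + δ⁻¹) + δ⁻¹ * ∫ ω, |W ω - ∑ k ∈ s, ξ k ω| ∂μ + δ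
      ≤ 2 * (B * δ ^ 2) * (2 + √(2 * π) + δ⁻¹) + δ⁻¹ * (Q * δ ^ 2) + δ := by gcongr
    _ = 2 * B * (2 + √(2 * π)) * δ * δ + (2 * B + Q + 1) * δ := by
        field_simp
        ring
    _ ≤ 2 * B * (2 + √(2 * π)) * δ * 1 + (2 * B + Q + 1) * δ := by gcongr
    _ = (2 * B * (3 + √(2 * π)) + Q + 1) * δ := by ring

end Smoothing

section Distributions

variable {A : Type*} {p : A → ℝ}

namespace IsDistribution

lemma mem_Icc (hp : IsDistribution p) (a : A) : p a ∈ Icc (0 : ℝ) 1 :=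
  ⟨hp.nonneg a, le_hasSum hp.hasSum a fun b _ => hp.nonneg b⟩

lemma summable_mul (hp : IsDistribution p) {f : A → ℝ} {C : ℝ} (hf : ∀ a, |f a| ≤ C) :
    Summable fun a => p a * f a := by
  refine (hp.hasSum.summable.mul_right C).of_norm_bounded fun a => ?_
  rw [norm_eq_abs, abs_mul, abs_of_nonneg (hp.nonneg a)]
  exact mul_le_mul_of_nonneg_left (hf a) (hp.nonneg a)

end IsDistribution

lemma sampleProp_mem_Icc (n : ℕ) (x : ℕ → A) (a : A) : sampleProp n x a ∈ Icc (0 : ℝ) 1 := by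
  have hletter (k : ℕ) : ({a} : Set A).indicator (fun _ => (1 : ℝ)) (x k) ∈ Icc (0 : ℝ) 1 :=
    ⟨indicator_nonneg (fun _ _ => zero_le_one) _, indicator_le_self' (fun _ _ => zero_le_one) _⟩
  have hcount : ∑ k ∈ Finset.range n, ({a} : Set A).indicator (fun _ => (1 : ℝ)) (x k) ≤ n := by
    simpa using Finset.sum_le_card_nsmul (Finset.range n) _ 1 fun k _ => (hletter k).2
  refine ⟨mul_nonneg (by positivity) (Finset.sum_nonneg fun k _ => (hletter k).1), ?_⟩
  rw [sampleProp, one_div_mul_eq_div]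
  exact div_le_one_of_le₀ hcount n.cast_nonneg

lemma finite_support_sampleProp (n : ℕ) (x : ℕ → A) :
    (Function.support (sampleProp n x)).Finite := by
  refine ((Finset.range n).finite_toSet.image x).subset fun a ha => ?_
  obtain ⟨k, hk, hka⟩ := Finset.exists_ne_zero_of_sum_ne_zero (right_ne_zero_of_mul ha)
  exact ⟨k, hk, mem_singleton_iff.1 (mem_of_indicator_ne_zero hka)⟩

lemma hasSum_mul_sampleProp (n : ℕ) (x : ℕ → A) (f : A → ℝ) :
    HasSum (fun a => f a * sampleProp n x a) (1 / n * ∑ k ∈ Finset.range n, f (x k)) := by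
  have hletter (k : ℕ) :
      HasSum (fun a => f a * ({a} : Set A).indicator (fun _ => (1 : ℝ)) (x k)) (f (x k)) := by
    convert hasSum_single (f := fun a => f a * ({a} : Set A).indicator (fun _ => (1 : ℝ)) (x k))
      (x k) fun a ha => ?_ using 1
    · simp
    · simp [ha.symm]
  refine ((hasSum_sum fun k (_ : k ∈ Finset.range n) => hletter k).mul_left (1 / (n : ℝ))).congr_fun
    fun a => ?_
  rw [sampleProp, ← Finset.mul_sum, mul_left_comm]

end Distributions

namespace IsIIDSample

variable {Ω A : Type*} [MeasurableSpace Ω] [MeasurableSpace A] [MeasurableSingletonClass A]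
  {μ : Measure Ω} {X : ℕ → Ω → A} {p : A → ℝ}

lemma measurable_letter (hX : IsIIDSample μ X p) (k : ℕ) (a : A) :
    Measurable fun ω => ({a} : Set A).indicator (fun _ => (1 : ℝ)) (X k ω) :=
  (measurable_const.indicator (measurableSet_singleton a)).comp (hX.measurable k)

lemma measurable_sampleProp (hX : IsIIDSample μ X p) (n : ℕ) (a : A) :
    Measurable fun ω => sampleProp n (fun k => X k ω) a :=
  (Finset.measurable_fun_sum _ fun k _ => hX.measurable_letter k a).const_mul _

lemma integral_letter (hX : IsIIDSample μ X p) (k : ℕ) (a : A) :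
    ∫ ω, ({a} : Set A).indicator (fun _ => (1 : ℝ)) (X k ω) ∂μ = p a := by
  rw [← hX.law k a]
  exact integral_indicator_one (hX.measurable k (measurableSet_singleton a))

variable [IsProbabilityMeasure μ]

lemma memLp_letter (hX : IsIIDSample μ X p) (k : ℕ) (a : A) :
    MemLp (fun ω => ({a} : Set A).indicator (fun _ => (1 : ℝ)) (X k ω)) 2 μ :=
  .of_bound (hX.measurable_letter k a).aestronglyMeasurable 1 <| .of_forall fun _ =>
    (norm_indicator_le_norm_self _ _).trans_eq norm_one

lemma variance_letter_le (hX : IsIIDSample μ X p) (k : ℕ) (a : A) :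
    Var[fun ω => ({a} : Set A).indicator (fun _ => (1 : ℝ)) (X k ω); μ] ≤ p a := by
  refine (variance_le_expectation_sq (hX.memLp_letter k a).1).trans_eq ?_
  rw [← hX.integral_letter k a]
  congr! 2 with ω
  by_cases h : X k ω = a <;> simp [h]

lemma integral_sampleProp (hX : IsIIDSample μ X p) {n : ℕ} (hn : n ≠ 0) (a : A) :
    ∫ ω, sampleProp n (fun k => X k ω) a ∂μ = p a := by
  simp only [sampleProp]
  rw [integral_const_mul, integral_finsetSum _ fun k _ =>
    (hX.memLp_letter k a).integrable one_le_two]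
  simp only [hX.integral_letter, Finset.sum_const, Finset.card_range, nsmul_eq_mul]
  field_simp

lemma variance_sampleProp_le (hX : IsIIDSample μ X p) (n : ℕ) (a : A) :
    Var[fun ω => sampleProp n (fun k => X k ω) a; μ] ≤ p a / n := by
  set ξ : ℕ → Ω → ℝ := fun k ω => ({a} : Set A).indicator (fun _ => (1 : ℝ)) (X k ω) with hξ
  have hindep : iIndepFun ξ μ :=
    hX.indep.comp _ fun _ => measurable_const.indicator (measurableSet_singleton a)
  calc Var[fun ω => sampleProp n (fun k => X k ω) a; μ]
      = (1 / (n : ℝ)) ^ 2 * Var[∑ k ∈ Finset.range n, ξ k; μ] := by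
        rw [← variance_const_mul]
        simp [sampleProp, hξ]
    _ = (1 / (n : ℝ)) ^ 2 * ∑ k ∈ Finset.range n, Var[ξ k; μ] := by
        rw [IndepFun.variance_sum (fun k _ => hX.memLp_letter k a)
          fun i _ j _ hij => hindep.indepFun hij]
    _ ≤ (1 / (n : ℝ)) ^ 2 * ∑ _k ∈ Finset.range n, p a := by
        gcongr with k
        exact hX.variance_letter_le k a
    _ = p a / n := by
        rw [Finset.sum_const, Finset.card_range, nsmul_eq_mul]
        rcases eq_or_ne (n : ℝ) 0 with h | h
        · simp [h]
        · field_simp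

lemma integral_sampleProp_sub_sq_le (hX : IsIIDSample μ X p) {n : ℕ} (hn : n ≠ 0) (a : A) :
    ∫ ω, (sampleProp n (fun k => X k ω) a - p a) ^ 2 ∂μ ≤ p a / n := by
  have hvar := hX.variance_sampleProp_le n a
  rwa [variance_eq_integral (hX.measurable_sampleProp n a).aemeasurable,
    hX.integral_sampleProp hn] at hvar

end IsIIDSample

section Moments

lemma rpow_one_add_le_add {β t y : ℝ} (h0 : 0 ≤ β) (h1 : β ≤ 1) (ht : 0 < t) (hy : 0 ≤ y) :
    y ^ (1 + β) ≤ t ^ β * y + t ^ (β - 1) * y ^ 2 := by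
  rcases le_total y t with hyt | hty
  · calc y ^ (1 + β) = y ^ β * y := by rw [add_comm, rpow_add_one' hy (by positivity)]
      _ ≤ t ^ β * y := by gcongr
      _ ≤ t ^ β * y + t ^ (β - 1) * y ^ 2 := le_add_of_nonneg_right (by positivity)
  · calc y ^ (1 + β) = y ^ (β - 1) * y ^ 2 := by
          rw [← rpow_two, ← rpow_add (ht.trans_le hty)]
          ring_nf
      _ ≤ t ^ (β - 1) * y ^ 2 := by
          gcongr ?_ * _
          exact rpow_le_rpow_of_nonpos ht hty (by linarith)
      _ ≤ t ^ β * y + t ^ (β - 1) * y ^ 2 := le_add_of_nonneg_left (by positivity)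

lemma rateExponent_mem_Icc {β : ℝ} (h0 : 0 ≤ β) (h1 : β ≤ 1) :
    rateExponent β ∈ Icc (0 : ℝ) (1 / 2) := by
  unfold rateExponent
  split_ifs <;> constructor <;> linarith

/-- A bound, up to the factor `n ^ (-(1 / 2 + γ))`, for the absolute moment of order `1 + β` of the
error of the sample proportion of the letter `a`. -/
noncomputable def momentCoeff {A : Type*} (β : ℝ) (p : A → ℝ) (a : A) : ℝ :=
  if β ≤ 1 / 2 then p a ^ ((β + 1) / 2) else 3 * p a

variable {A : Type*} {p : A → ℝ} {β : ℝ}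

lemma summable_momentCoeff (hp : IsDistribution p)
    (hcond : 1 / 2 < β ∨ (β ≤ 1 / 2 ∧ Summable fun a => p a ^ ((β + 1) / 2))) :
    Summable (momentCoeff β p) := by
  unfold momentCoeff
  rcases hcond with hβ | ⟨hβ, hsum⟩
  · simpa only [if_neg hβ.not_ge] using hp.hasSum.summable.mul_left 3
  · simpa only [if_pos hβ] using hsum

namespace IsIIDSample

variable {Ω : Type*} [MeasurableSpace Ω] [MeasurableSpace A] [MeasurableSingletonClass A]
  {μ : Measure Ω} [IsProbabilityMeasure μ] {X : ℕ → Ω → A} {n : ℕ}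

lemma integrable_abs_sampleProp_sub_rpow (hX : IsIIDSample μ X p) (hp : IsDistribution p) (n : ℕ)
    (a : A) {r : ℝ} (hr : 0 ≤ r) :
    Integrable (fun ω => |sampleProp n (fun k => X k ω) a - p a| ^ r) μ := by
  have hmeas := ((hX.measurable_sampleProp n a).sub_const (p a)).abs.pow_const r
  refine .of_bound hmeas.aestronglyMeasurable 1 (.of_forall fun ω => ?_)
  rw [norm_of_nonneg (by positivity)]
  exact rpow_le_one (abs_nonneg _)
    (Real.dist_le_of_mem_Icc_01 (sampleProp_mem_Icc n _ a) (hp.mem_Icc a)) hr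

lemma integral_abs_sampleProp_sub_le (hX : IsIIDSample μ X p) (hp : IsDistribution p) (hn : n ≠ 0)
    (a : A) : ∫ ω, |sampleProp n (fun k => X k ω) a - p a| ∂μ ≤ 2 * p a := by
  have hint : Integrable (fun ω => sampleProp n (fun k => X k ω) a) μ :=
    .of_bound (hX.measurable_sampleProp n a).aestronglyMeasurable 1 <| .of_forall fun ω => by
      rw [norm_of_nonneg (sampleProp_mem_Icc n _ a).1]
      exact (sampleProp_mem_Icc n _ a).2
  calc ∫ ω, |sampleProp n (fun k => X k ω) a - p a| ∂μ
      ≤ ∫ ω, (sampleProp n (fun k => X k ω) a + p a) ∂μ := by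
        refine integral_mono (hint.sub (integrable_const _)).abs (hint.add (integrable_const _))
          fun ω => abs_le.2 ?_
        constructor <;> linarith [(sampleProp_mem_Icc n (fun k => X k ω) a).1, hp.nonneg a]
    _ = 2 * p a := by
        rw [integral_add hint (integrable_const _), hX.integral_sampleProp hn, integral_const,
          probReal_univ, one_smul, two_mul]

lemma integral_abs_sampleProp_sub_rpow_le_mul (hX : IsIIDSample μ X p) (hp : IsDistribution p)
    (hn : n ≠ 0) (a : A) (h0 : 0 ≤ β) (h1 : β ≤ 1) :
    ∫ ω, |sampleProp n (fun k => X k ω) a - p a| ^ (1 + β) ∂μ ≤ 3 * p a * (n : ℝ) ^ (-β) := by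
  have hn0 : (0 : ℝ) < n := by positivity
  set D : Ω → ℝ := fun ω => |sampleProp n (fun k => X k ω) a - p a| with hD
  have hint : Integrable D μ := by
    simpa using hX.integrable_abs_sampleProp_sub_rpow hp n a zero_le_one
  have hint2 : Integrable (fun ω => D ω ^ 2) μ := by
    simpa [hD] using hX.integrable_abs_sampleProp_sub_rpow hp n a zero_le_two
  have hsq : ∫ ω, D ω ^ 2 ∂μ ≤ p a / n := by
    simpa only [hD, sq_abs] using hX.integral_sampleProp_sub_sq_le hn a
  -- At `t = 1 / n` both terms of `rpow_one_add_le_add` contribute at most a multiple of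
  -- `p a * n ^ (-β)`.
  calc ∫ ω, D ω ^ (1 + β) ∂μ
      ≤ ∫ ω, (((n : ℝ)⁻¹ ^ β) * D ω + (n : ℝ)⁻¹ ^ (β - 1) * D ω ^ 2) ∂μ :=
        integral_mono (hX.integrable_abs_sampleProp_sub_rpow hp n a (by linarith))
          ((hint.const_mul _).add (hint2.const_mul _))
          fun ω => rpow_one_add_le_add h0 h1 (inv_pos.2 hn0) (abs_nonneg _)
    _ = (n : ℝ)⁻¹ ^ β * ∫ ω, D ω ∂μ + (n : ℝ)⁻¹ ^ (β - 1) * ∫ ω, D ω ^ 2 ∂μ := by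
        rw [integral_add (hint.const_mul _) (hint2.const_mul _), integral_const_mul,
          integral_const_mul]
    _ ≤ (n : ℝ)⁻¹ ^ β * (2 * p a) + (n : ℝ)⁻¹ ^ (β - 1) * (p a / n) := by
        gcongr
        exact hX.integral_abs_sampleProp_sub_le hp hn a
    _ = 3 * p a * (n : ℝ) ^ (-β) := by
        rw [rpow_sub_one (inv_pos.2 hn0).ne', inv_rpow hn0.le, rpow_neg hn0.le]
        field_simp
        ring

lemma integral_abs_sampleProp_sub_rpow_le_rpow (hX : IsIIDSample μ X p) (hp : IsDistribution p)
    (hn : n ≠ 0) (a : A) (h0 : 0 ≤ β) (h1 : β ≤ 1) :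
    ∫ ω, |sampleProp n (fun k => X k ω) a - p a| ^ (1 + β) ∂μ ≤ (p a / n) ^ ((β + 1) / 2) := by
  have hsq (ω : Ω) : |sampleProp n (fun k => X k ω) a - p a| ^ (1 + β) =
      ((sampleProp n (fun k => X k ω) a - p a) ^ 2) ^ ((β + 1) / 2) := by
    rw [← sq_abs, ← rpow_two, ← rpow_mul (abs_nonneg _)]
    ring_nf
  have hint : Integrable (fun ω => (sampleProp n (fun k => X k ω) a - p a) ^ 2) μ := by
    simpa using hX.integrable_abs_sampleProp_sub_rpow hp n a zero_le_two
  have hint' := hX.integrable_abs_sampleProp_sub_rpow hp n a (add_nonneg zero_le_one h0)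
  simp only [hsq] at hint' ⊢
  refine ((concaveOn_rpow (by linarith) (by linarith)).le_map_integral
    (continuousOn_id.rpow_const fun _ _ => .inr (by linarith)) isClosed_Ici
    (.of_forall fun ω => mem_Ici.2 (sq_nonneg _)) hint hint').trans ?_
  gcongr
  exact hX.integral_sampleProp_sub_sq_le hn a

lemma integral_abs_sampleProp_sub_rpow_le (hX : IsIIDSample μ X p) (hp : IsDistribution p)
    (hn : n ≠ 0) (a : A) (h0 : 0 ≤ β) (h1 : β ≤ 1) :
    ∫ ω, |sampleProp n (fun k => X k ω) a - p a| ^ (1 + β) ∂μ ≤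
      momentCoeff β p a * (n : ℝ) ^ (-(1 / 2 + rateExponent β)) := by
  unfold momentCoeff rateExponent
  split_ifs with hβ
  · convert hX.integral_abs_sampleProp_sub_rpow_le_rpow hp hn a h0 h1 using 1
    rw [div_rpow (hp.nonneg a) n.cast_nonneg, div_eq_mul_inv _ ((n : ℝ) ^ _),
      ← rpow_neg n.cast_nonneg]
    ring_nf
  · convert hX.integral_abs_sampleProp_sub_rpow_le_mul hp hn a h0 h1 using 2
    ring_nf

end IsIIDSample

end Moments

section LinearApproximation

lemma abs_sub_sub_mul_le_of_holderOnWith {f f' : ℝ → ℝ} {s : Set ℝ} {M β : ℝ≥0} (hs : Convex ℝ s)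
    (hf : ∀ x ∈ s, HasDerivWithinAt f (f' x) s x) (hf' : HolderOnWith M β f' s) {x y : ℝ}
    (hx : x ∈ s) (hy : y ∈ s) :
    |f y - f x - f' x * (y - x)| ≤ M * |y - x| ^ (1 + (β : ℝ)) := by
  have hsub : uIcc x y ⊆ s := hs.ordConnected.uIcc_subset hx hy
  have hderiv (t : ℝ) (ht : t ∈ uIcc x y) :
      HasDerivWithinAt (fun t => f t - f' x * t) (f' t - f' x) (uIcc x y) t :=
    ((hf t (hsub ht)).mono hsub).sub (hasDerivWithinAt_id t _ |>.const_mul (f' x) |>.congr_deriv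
      (mul_one _))
  have hbound (t : ℝ) (ht : t ∈ uIcc x y) : ‖f' t - f' x‖ ≤ M * |y - x| ^ (β : ℝ) := by
    refine (hf'.dist_le (hsub ht) hx).trans ?_
    gcongr
    exact abs_sub_left_of_mem_uIcc ht
  calc |f y - f x - f' x * (y - x)| = ‖(f y - f' x * y) - (f x - f' x * x)‖ := by
        rw [norm_eq_abs]
        ring_nf
    _ ≤ M * |y - x| ^ (β : ℝ) * ‖y - x‖ :=
        (convex_uIcc x y).norm_image_sub_le_of_norm_hasDerivWithin_le hderiv hbound
          left_mem_uIcc right_mem_uIcc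
    _ = M * |y - x| ^ (1 + (β : ℝ)) := by
        rw [norm_eq_abs, add_comm, rpow_add_one' (abs_nonneg _) (by positivity), mul_assoc]

/-- The error at `y` of the first-order Taylor approximation of `g` at `x`. -/
noncomputable def taylorError (g : ℝ → ℝ) (x y : ℝ) : ℝ :=
  g y - g x - deriv01 g x * (y - x)

lemma abs_taylorError_le {g : ℝ → ℝ} {M β : ℝ≥0} (hg : DifferentiableOn ℝ g (Icc 0 1))
    (hM : HolderOnWith M β (deriv01 g) (Icc 0 1)) {x y : ℝ} (hx : x ∈ Icc (0 : ℝ) 1)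
    (hy : y ∈ Icc (0 : ℝ) 1) : |taylorError g x y| ≤ M * |y - x| ^ (1 + (β : ℝ)) :=
  abs_sub_sub_mul_le_of_holderOnWith (convex_Icc 0 1) (fun x hx => (hg x hx).hasDerivWithinAt) hM
    hx hy

lemma abs_le_of_holderOnWith_Icc {f : ℝ → ℝ} {M β : ℝ≥0} (hf : HolderOnWith M β f (Icc 0 1))
    {x : ℝ} (hx : x ∈ Icc (0 : ℝ) 1) : |f x| ≤ |f 0| + M := by
  have h0 : (0 : ℝ) ∈ Icc (0 : ℝ) 1 := by simp
  have hdist : |f x - f 0| ≤ M := by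
    refine (hf.dist_le hx h0).trans (mul_le_of_le_one_right M.2 ?_)
    exact rpow_le_one dist_nonneg (Real.dist_le_of_mem_Icc_01 hx h0) β.2
  linarith [abs_sub_abs_le_abs_sub (f x) (f 0)]

end LinearApproximation

section Series

variable {Ω ι : Type*} [MeasurableSpace Ω] [Countable ι] {μ : Measure Ω} {f : ι → Ω → ℝ}
  {B : ι → ℝ}

lemma lintegral_enorm_tsum_le (hf : ∀ i, Integrable (f i) μ) (hfB : ∀ i, ∫ ω, |f i ω| ∂μ ≤ B i)
    (hB : Summable B) : ∫⁻ ω, ‖∑' i, f i ω‖ₑ ∂μ ≤ ENNReal.ofReal (∑' i, B i) :=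
  calc ∫⁻ ω, ‖∑' i, f i ω‖ₑ ∂μ ≤ ∫⁻ ω, ∑' i, ‖f i ω‖ₑ ∂μ :=
        lintegral_mono fun _ => enorm_tsum_le_tsum_enorm
    _ = ∑' i, ∫⁻ ω, ‖f i ω‖ₑ ∂μ := lintegral_tsum fun i => (hf i).1.enorm
    _ ≤ ∑' i, ENNReal.ofReal (B i) := by
        gcongr with i
        rw [← ofReal_integral_norm_eq_lintegral_enorm (hf i)]
        exact ENNReal.ofReal_le_ofReal (hfB i)
    _ = ENNReal.ofReal (∑' i, B i) :=
        (ENNReal.ofReal_tsum_of_nonneg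
          (fun i => (integral_nonneg fun _ => abs_nonneg _).trans (hfB i)) hB).symm

lemma integrable_tsum_of_integral_abs_le (hf : ∀ i, Integrable (f i) μ)
    (hfB : ∀ i, ∫ ω, |f i ω| ∂μ ≤ B i) (hB : Summable B) :
    Integrable (fun ω => ∑' i, f i ω) μ :=
  ⟨(AEMeasurable.tsum fun i => (hf i).1.aemeasurable).aestronglyMeasurable,
    (lintegral_enorm_tsum_le hf hfB hB).trans_lt ENNReal.ofReal_lt_top⟩

lemma integral_abs_tsum_le (hf : ∀ i, Integrable (f i) μ) (hfB : ∀ i, ∫ ω, |f i ω| ∂μ ≤ B i)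
    (hB : Summable B) : ∫ ω, |∑' i, f i ω| ∂μ ≤ ∑' i, B i := by
  have hB0 (i : ι) : 0 ≤ B i := (integral_nonneg fun _ => abs_nonneg _).trans (hfB i)
  rw [← ENNReal.ofReal_le_ofReal_iff (tsum_nonneg hB0)]
  exact (ofReal_integral_norm_eq_lintegral_enorm
    (integrable_tsum_of_integral_abs_le hf hfB hB)).trans_le (lintegral_enorm_tsum_le hf hfB hB)

end Series

/-- The centred influence function `g'(p a) - ∑ p b * g'(p b)` of the index at `p`. -/
noncomputable def score {A : Type*} (g : ℝ → ℝ) (p : A → ℝ) (a : A) : ℝ :=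
  deriv01 g (p a) - ∑' b, p b * deriv01 g (p b)

/-- The error in approximating `plugIn g n x - index g p` by the mean score of the first `n`
observations. -/
noncomputable def remainder {A : Type*} (g : ℝ → ℝ) (p : A → ℝ) (n : ℕ) (x : ℕ → A) : ℝ :=
  plugIn g n x - index g p - 1 / n * ∑ k ∈ Finset.range n, score g p (x k)

section Remainder

variable {A : Type*} {g : ℝ → ℝ} {p : A → ℝ} {n : ℕ} {G : ℝ}

lemma abs_score_le (hp : IsDistribution p) (hG : ∀ a, |deriv01 g (p a)| ≤ G) (a : A) :
    |score g p a| ≤ 2 * G := by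
  have hmean : ‖∑' b, p b * deriv01 g (p b)‖ ≤ 1 * G := by
    refine tsum_of_norm_bounded (hp.hasSum.mul_right G) fun b => ?_
    rw [norm_eq_abs, abs_mul, abs_of_nonneg (hp.nonneg b)]
    exact mul_le_mul_of_nonneg_left (hG b) (hp.nonneg b)
  calc |score g p a| ≤ |deriv01 g (p a)| + ‖∑' b, p b * deriv01 g (p b)‖ := abs_sub _ _
    _ ≤ 2 * G := by linarith [hG a]

lemma apply_zero_eq_zero_of_summable_comp [Infinite A] (hg : ContinuousOn g (Icc 0 1))
    (hp : IsDistribution p) (hgp : Summable fun a => g (p a)) : g 0 = 0 := by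
  have hp0 : Tendsto p cofinite (nhdsWithin 0 (Icc 0 1)) :=
    tendsto_nhdsWithin_iff.2 ⟨hp.hasSum.summable.tendsto_cofinite_zero, .of_forall hp.mem_Icc⟩
  exact tendsto_nhds_unique ((hg 0 (by simp)).tendsto.comp hp0) hgp.tendsto_cofinite_zero

lemma summable_comp_sampleProp (hg : ContinuousOn g (Icc 0 1)) (hp : IsDistribution p)
    (hgp : Summable fun a => g (p a)) (n : ℕ) (x : ℕ → A) :
    Summable fun a => g (sampleProp n x a) := by
  cases finite_or_infinite A
  · exact summable_of_hasFiniteSupport (toFinite _)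
  · refine summable_of_hasFiniteSupport ((finite_support_sampleProp n x).subset ?_)
    exact Function.support_comp_subset (apply_zero_eq_zero_of_summable_comp hg hp hgp) _

lemma hasSum_remainder (hg : ContinuousOn g (Icc 0 1)) (hp : IsDistribution p)
    (hgp : Summable fun a => g (p a)) (hG : ∀ a, |deriv01 g (p a)| ≤ G) (hn : n ≠ 0)
    (x : ℕ → A) :
    HasSum (fun a => taylorError g (p a) (sampleProp n x a)) (remainder g p n x) := by
  have hvalues := (summable_comp_sampleProp hg hp hgp n x).hasSum.sub hgp.hasSum
  have hderivs := (hasSum_mul_sampleProp n x fun a => deriv01 g (p a)).sub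
    (hp.summable_mul hG).hasSum
  have hremainder : remainder g p n x = plugIn g n x - index g p -
      (1 / n * ∑ k ∈ Finset.range n, deriv01 g (p (x k)) - ∑' a, p a * deriv01 g (p a)) := by
    simp only [remainder, score, Finset.sum_sub_distrib, Finset.sum_const, Finset.card_range,
      nsmul_eq_mul]
    field_simp
  rw [hremainder]
  exact (hvalues.sub hderivs).congr_fun fun a => by
    unfold taylorError
    ring

lemma remainder_eq_tsum {M β : ℝ≥0} (hp : IsDistribution p) (hg : DifferentiableOn ℝ g (Icc 0 1))
    (hM : HolderOnWith M β (deriv01 g) (Icc 0 1)) (hgp : Summable fun a => g (p a)) (hn : n ≠ 0)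
    (x : ℕ → A) : remainder g p n x = ∑' a, taylorError g (p a) (sampleProp n x a) :=
  (hasSum_remainder hg.continuousOn hp hgp
    (fun a => abs_le_of_holderOnWith_Icc hM (hp.mem_Icc a)) hn x).tsum_eq.symm

lemma abs_normalized_score_le (hp : IsDistribution p) (hG : ∀ a, |deriv01 g (p a)| ≤ G) (n : ℕ)
    (a : A) :
    |(√(asympVar g p) * √n)⁻¹ * score g p a| ≤ (√(asympVar g p) * √n)⁻¹ * (2 * G) := by
  rw [abs_mul, abs_of_nonneg (by positivity : 0 ≤ (√(asympVar g p) * √n)⁻¹)]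
  gcongr
  exact abs_score_le hp hG a

lemma normalized_sub_sum_score (n : ℕ) (x : ℕ → A) :
    √n / √(asympVar g p) * (plugIn g n x - index g p) -
        ∑ k ∈ Finset.range n, (√(asympVar g p) * √n)⁻¹ * score g p (x k) =
      √n / √(asympVar g p) * remainder g p n x := by
  have hscale : (√(asympVar g p) * √n)⁻¹ = √n / √(asympVar g p) * (1 / n) := by
    rw [mul_inv, ← sqrt_div_self (x := (n : ℝ))]
    ring
  rw [← Finset.mul_sum, hscale, remainder]
  ring

end Remainder

namespace IsIIDSample

variable {Ω A : Type*} [MeasurableSpace Ω] [MeasurableSpace A] [MeasurableSingletonClass A]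
  {μ : Measure Ω} {X : ℕ → Ω → A} {p : A → ℝ} {g : ℝ → ℝ} {M β : ℝ≥0} {G : ℝ} {n : ℕ}

lemma measurable_comp_sampleProp (hX : IsIIDSample μ X p) (hg : ContinuousOn g (Icc 0 1)) (n : ℕ)
    (a : A) : Measurable fun ω => g (sampleProp n (fun k => X k ω) a) :=
  (continuousOn_iff_continuous_domRestrict.1 hg).measurable.comp
    ((hX.measurable_sampleProp n a).subtype_mk (h := fun _ => sampleProp_mem_Icc n _ a))

section TaylorError

variable [IsProbabilityMeasure μ]

lemma integrable_taylorError (hX : IsIIDSample μ X p) (hp : IsDistribution p)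
    (hg : DifferentiableOn ℝ g (Icc 0 1)) (hM : HolderOnWith M β (deriv01 g) (Icc 0 1)) (n : ℕ)
    (a : A) :
    Integrable (fun ω => taylorError g (p a) (sampleProp n (fun k => X k ω) a)) μ := by
  refine ((hX.integrable_abs_sampleProp_sub_rpow hp n a (r := 1 + β) (by positivity)).const_mul
    M).mono' ?_ (.of_forall fun ω => abs_taylorError_le hg hM (hp.mem_Icc a)
      (sampleProp_mem_Icc n _ a))
  exact (((hX.measurable_comp_sampleProp hg.continuousOn n a).sub_const _).sub
    (((hX.measurable_sampleProp n a).sub_const _).const_mul _)).aestronglyMeasurable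

lemma integral_abs_taylorError_le (hX : IsIIDSample μ X p) (hp : IsDistribution p)
    (hg : DifferentiableOn ℝ g (Icc 0 1)) (hM : HolderOnWith M β (deriv01 g) (Icc 0 1))
    (hβ : β ≤ 1) (hn : n ≠ 0) (a : A) :
    ∫ ω, |taylorError g (p a) (sampleProp n (fun k => X k ω) a)| ∂μ ≤
      M * (momentCoeff β p a * (n : ℝ) ^ (-(1 / 2 + rateExponent β))) :=
  calc ∫ ω, |taylorError g (p a) (sampleProp n (fun k => X k ω) a)| ∂μ
      ≤ ∫ ω, M * |sampleProp n (fun k => X k ω) a - p a| ^ (1 + (β : ℝ)) ∂μ :=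
        integral_mono (hX.integrable_taylorError hp hg hM n a).abs
          ((hX.integrable_abs_sampleProp_sub_rpow hp n a (by positivity)).const_mul _) fun ω =>
          abs_taylorError_le hg hM (hp.mem_Icc a) (sampleProp_mem_Icc n _ a)
    _ ≤ M * (momentCoeff β p a * (n : ℝ) ^ (-(1 / 2 + rateExponent β))) := by
        rw [integral_const_mul]
        gcongr
        exact hX.integral_abs_sampleProp_sub_rpow_le hp hn a β.2 hβ

end TaylorError

variable [Countable A]

lemma measurable_plugIn (hX : IsIIDSample μ X p) (hg : ContinuousOn g (Icc 0 1)) (n : ℕ) :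
    Measurable fun ω => plugIn g n (fun k => X k ω) :=
  Measurable.tsum fun a => hX.measurable_comp_sampleProp hg n a

lemma measurable_comp (hX : IsIIDSample μ X p) (f : A → ℝ) (k : ℕ) :
    Measurable fun ω => f (X k ω) :=
  (measurable_of_countable f).comp (hX.measurable k)

lemma iIndepFun_comp (hX : IsIIDSample μ X p) (f : A → ℝ) : iIndepFun (fun k ω => f (X k ω)) μ :=
  hX.indep.comp (fun _ => f) fun _ => measurable_of_countable f

variable [IsProbabilityMeasure μ]

lemma memLp_comp (hX : IsIIDSample μ X p) {f : A → ℝ} {C : ℝ} (hf : ∀ a, |f a| ≤ C) (k : ℕ) :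
    MemLp (fun ω => f (X k ω)) 2 μ :=
  .of_bound (hX.measurable_comp f k).aestronglyMeasurable C (.of_forall fun _ => hf _)

lemma integral_comp (hX : IsIIDSample μ X p) {f : A → ℝ} {C : ℝ} (hf : ∀ a, |f a| ≤ C) (k : ℕ) :
    ∫ ω, f (X k ω) ∂μ = ∑' a, p a * f a := by
  have _ := Measure.isProbabilityMeasure_map (μ := μ) (hX.measurable k).aemeasurable
  have hfm : Measurable f := measurable_of_countable f
  rw [← integral_map (hX.measurable k).aemeasurable hfm.aestronglyMeasurable,
    integral_countable (.of_bound hfm.aestronglyMeasurable C (.of_forall hf))]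
  congr! 2 with a
  rw [map_measureReal_apply (hX.measurable k) (measurableSet_singleton a), smul_eq_mul,
    ← hX.law k a]
  rfl

lemma integral_score (hX : IsIIDSample μ X p) (hG : ∀ a, |deriv01 g (p a)| ≤ G) (k : ℕ) :
    ∫ ω, score g p (X k ω) ∂μ = 0 := by
  simp only [score]
  rw [integral_sub ((hX.memLp_comp hG k).integrable one_le_two) (integrable_const _),
    hX.integral_comp hG, integral_const, probReal_univ, one_smul, sub_self]

lemma variance_score (hX : IsIIDSample μ X p) (hG : ∀ a, |deriv01 g (p a)| ≤ G) (k : ℕ) :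
    Var[fun ω => score g p (X k ω); μ] = asympVar g p := by
  have hG2 (a : A) : |deriv01 g (p a) ^ 2| ≤ G ^ 2 := by
    rw [abs_pow]
    gcongr
    exact hG a
  simp only [score, asympVar]
  rw [variance_sub_const (hX.measurable_comp (fun a => deriv01 g (p a)) k).aestronglyMeasurable,
    variance_eq_sub (hX.memLp_comp hG k), ← hX.integral_comp hG k, ← hX.integral_comp hG2 k]
  rfl

lemma integrable_remainder (hX : IsIIDSample μ X p) (hp : IsDistribution p)
    (hg : DifferentiableOn ℝ g (Icc 0 1)) (hM : HolderOnWith M β (deriv01 g) (Icc 0 1))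
    (hgp : Summable fun a => g (p a)) (hβ : β ≤ 1) (hsum : Summable (momentCoeff β p))
    (hn : n ≠ 0) : Integrable (fun ω => remainder g p n fun k => X k ω) μ := by
  simp only [remainder_eq_tsum hp hg hM hgp hn]
  exact integrable_tsum_of_integral_abs_le (hX.integrable_taylorError hp hg hM n)
    (hX.integral_abs_taylorError_le hp hg hM hβ hn) ((hsum.mul_right _).mul_left _)

lemma integral_abs_remainder_le (hX : IsIIDSample μ X p) (hp : IsDistribution p)
    (hg : DifferentiableOn ℝ g (Icc 0 1)) (hM : HolderOnWith M β (deriv01 g) (Icc 0 1))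
    (hgp : Summable fun a => g (p a)) (hβ : β ≤ 1) (hsum : Summable (momentCoeff β p))
    (hn : n ≠ 0) :
    ∫ ω, |remainder g p n fun k => X k ω| ∂μ ≤
      M * (∑' a, momentCoeff β p a) * (n : ℝ) ^ (-(1 / 2 + rateExponent β)) := by
  simp only [remainder_eq_tsum hp hg hM hgp hn]
  refine (integral_abs_tsum_le (hX.integrable_taylorError hp hg hM n)
    (hX.integral_abs_taylorError_le hp hg hM hβ hn) ((hsum.mul_right _).mul_left _)).trans_eq ?_
  rw [tsum_mul_left, tsum_mul_right, mul_assoc]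

lemma sum_variance_normalized_score (hX : IsIIDSample μ X p)
    (hG : ∀ a, |deriv01 g (p a)| ≤ G) (hσ : 0 < asympVar g p) (hn : n ≠ 0) :
    ∑ k ∈ Finset.range n, Var[fun ω => (√(asympVar g p) * √n)⁻¹ * score g p (X k ω); μ] = 1 := by
  simp only [variance_const_mul, hX.variance_score hG, Finset.sum_const, Finset.card_range,
    nsmul_eq_mul, inv_pow, mul_pow, sq_sqrt hσ.le, sq_sqrt n.cast_nonneg]
  field_simp

theorem abs_measureReal_plugIn_le_sub_cdf_le (hX : IsIIDSample μ X p) (hp : IsDistribution p)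
    (hg : ContinuousOn g (Icc 0 1)) (hG : ∀ a, |deriv01 g (p a)| ≤ G) (hσ : 0 < asympVar g p)
    (hn : n ≠ 0) (hR : Integrable (fun ω => remainder g p n fun k => X k ω) μ) {γ Q : ℝ}
    (hγ : γ ∈ Icc (0 : ℝ) (1 / 2))
    (hQ : ∫ ω, |remainder g p n fun k => X k ω| ∂μ ≤ Q * (n : ℝ) ^ (-(1 / 2 + γ))) (x : ℝ) :
    |μ.real {ω | √n / √(asympVar g p) * (plugIn g n (fun k => X k ω) - index g p) ≤ x} -
        cdf (gaussianReal 0 1) x| ≤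
      (2 * (2 * G / √(asympVar g p)) * (3 + √(2 * π)) + Q / √(asympVar g p) + 1) /
        (n : ℝ) ^ (γ / 2) := by
  have hn1 : (1 : ℝ) ≤ n := Nat.one_le_cast.2 (Nat.one_le_iff_ne_zero.2 hn)
  have := sqrt_pos.2 hσ
  have hδ : ((n : ℝ) ^ (-(γ / 2))) ^ 2 = (n : ℝ) ^ (-γ) := by
    rw [← rpow_mul_natCast n.cast_nonneg]
    ring_nf
  have hscale : (√n)⁻¹ ≤ (n : ℝ) ^ (-γ) := by
    rw [sqrt_eq_rpow, ← rpow_neg n.cast_nonneg]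
    exact rpow_le_rpow_of_exponent_le hn1 (neg_le_neg hγ.2)
  have hG0 : 0 ≤ G := by
    obtain ⟨ω⟩ := μ.nonempty_of_neZero
    exact (abs_nonneg _).trans (hG (X 0 ω))
  rw [div_eq_mul_inv _ ((n : ℝ) ^ (γ / 2)), ← rpow_neg n.cast_nonneg]
  refine abs_measureReal_le_sub_cdf_le (s := Finset.range n)
    (hX.iIndepFun_comp fun a => (√(asympVar g p) * √n)⁻¹ * score g p a)
    (fun k => ((hX.measurable_comp (score g p) k).const_mul _).aemeasurable)
    (fun k => .of_forall fun ω => abs_normalized_score_le hp hG n (X k ω))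
    (fun k => by rw [integral_const_mul, hX.integral_score hG, mul_zero])
    (hX.sum_variance_normalized_score hG hσ hn)
    (((hX.measurable_plugIn hg n).sub_const _).const_mul _).aemeasurable ?_
    (by positivity) (rpow_le_one_of_one_le_of_nonpos hn1 (by linarith [hγ.1])) (by positivity)
    ?_ ?_ x
  · simpa only [normalized_sub_sum_score] using hR.const_mul _
  · calc (√(asympVar g p) * √n)⁻¹ * (2 * G) = 2 * G / √(asympVar g p) * (√n)⁻¹ := by ring
      _ ≤ 2 * G / √(asympVar g p) * ((n : ℝ) ^ (-(γ / 2))) ^ 2 := by rw [hδ]; gcongr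
  · have hrate : √n * (n : ℝ) ^ (-(1 / 2 + γ)) = (n : ℝ) ^ (-γ) := by
      rw [sqrt_eq_rpow, ← rpow_add (zero_lt_one.trans_le hn1)]
      ring_nf
    simp only [normalized_sub_sum_score, abs_mul, integral_const_mul]
    rw [abs_of_nonneg (by positivity : 0 ≤ √n / √(asympVar g p)), hδ, ← hrate]
    calc √n / √(asympVar g p) * ∫ ω, |remainder g p n fun k => X k ω| ∂μ
        ≤ √n / √(asympVar g p) * (Q * (n : ℝ) ^ (-(1 / 2 + γ))) := by gcongr
      _ = Q / √(asympVar g p) * (√n * (n : ℝ) ^ (-(1 / 2 + γ))) := by ring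

end IsIIDSample

end DiversityIndex

theorem corollary2p2_general
    {A : Type*} [Countable A] [MeasurableSpace A] [MeasurableSingletonClass A]
    (g : ℝ → ℝ) (β : ℝ≥0) (p : A → ℝ) (hβ1 : β ≤ 1)
    (hg : DifferentiableOn ℝ g (Set.Icc 0 1))
    (hg' : ∃ M : ℝ≥0, HolderOnWith M β (DiversityIndex.deriv01 g) (Set.Icc 0 1))
    (hp : DiversityIndex.IsDistribution p)
    (hgp : Summable fun a => |g (p a)|)
    (hσ : 0 < DiversityIndex.asympVar g p)
    (hcond : (1 / 2 < (β : ℝ)) ∨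
      ((β : ℝ) ≤ 1 / 2 ∧ Summable fun a => p a ^ (((β : ℝ) + 1) / 2))) :
    ∃ C : ℝ, ∀ (Ω : Type*) [MeasurableSpace Ω] (μ : Measure Ω) [IsProbabilityMeasure μ]
      (X : ℕ → Ω → A), DiversityIndex.IsIIDSample μ X p →
      ∀ n : ℕ, 1 ≤ n → ∀ x : ℝ,
        |μ.real {ω | √(n : ℝ) / √(DiversityIndex.asympVar g p) *
              (DiversityIndex.plugIn g n (fun k => X k ω) - DiversityIndex.index g p) ≤ x}
            - cdf (gaussianReal 0 1) x|
          ≤ C / (n : ℝ) ^ (DiversityIndex.rateExponent (β : ℝ) / 2) := by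
  obtain ⟨M, hM⟩ := hg'
  have hsum := DiversityIndex.summable_momentCoeff hp hcond
  have hG (a : A) := DiversityIndex.abs_le_of_holderOnWith_Icc hM (hp.mem_Icc a)
  exact ⟨_, fun Ω _ μ _ X hX n hn x =>
    have hn0 : n ≠ 0 := Nat.one_le_iff_ne_zero.1 hn
    hX.abs_measureReal_plugIn_le_sub_cdf_le hp hg.continuousOn hG hσ hn0
      (hX.integrable_remainder hp hg hM hgp.of_abs hβ1 hsum hn0)
      (DiversityIndex.rateExponent_mem_Icc β.2 hβ1)
      (hX.integral_abs_remainder_le hp hg hM hgp.of_abs hβ1 hsum hn0) x⟩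

theorem corollary2p2
    {A : Type*} [Countable A] [Infinite A] [MeasurableSpace A] [MeasurableSingletonClass A]
    (g : ℝ → ℝ) (β : ℝ≥0) (p : A → ℝ)
    (hβ0 : 0 < β) (hβ1 : β ≤ 1)
    (hg : DifferentiableOn ℝ g (Set.Icc 0 1))
    (hg' : ∃ M : ℝ≥0, HolderOnWith M β (DiversityIndex.deriv01 g) (Set.Icc 0 1))
    (hp : DiversityIndex.IsDistribution p)
    (hgp : Summable fun a => |g (p a)|)
    (hσ : 0 < DiversityIndex.asympVar g p)
    (hcond : (1 / 2 < (β : ℝ)) ∨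
      ((β : ℝ) ≤ 1 / 2 ∧ Summable fun a => p a ^ (((β : ℝ) + 1) / 2))) :
    ∃ C : ℝ, ∀ (Ω : Type*) [MeasurableSpace Ω] (μ : Measure Ω) [IsProbabilityMeasure μ]
      (X : ℕ → Ω → A), DiversityIndex.IsIIDSample μ X p →
      ∀ n : ℕ, 1 ≤ n → ∀ x : ℝ,
        |μ.real {ω | √(n : ℝ) / √(DiversityIndex.asympVar g p) *
              (DiversityIndex.plugIn g n (fun k => X k ω) - DiversityIndex.index g p) ≤ x}
            - cdf (gaussianReal 0 1) x|
          ≤ C / (n : ℝ) ^ (DiversityIndex.rateExponent (β : ℝ) / 2) :=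
  corollary2p2_general g β p hβ1 hg hg' hp hgp hσ hcond
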